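/- Let $\mathbf{H}^3$ be hyperbolic $3$-space, in the upper half space model $\mathbb{C}\times(0,\infty)$, let $\mathbf{I}$ be its full isometry group, and let $\mathbf{S}=\mathbb{C}\cup\{\infty\}$ be its ideal boundary; every element of $\mathbf{I}$ extends continuously to a homeomorphism of $\mathbf{S}$. A *nice lattice* is a subgroup $\Gamma\subset\mathbf{I}$ such that $\mathbf{H}^3\to\mathbf{H}^3/\Gamma$ is a covering map with deck group $\Gamma$ and $\mathbf{H}^3/\Gamma$ is compact. An *equivariant pair* $(H,h)$ consists of a bi-Lipschitz bijection $H:\mathbf{H}^3\to\mathbf{H}^3$ (that is, for some $K\ge 1$, $K^{-1}d(x,y)\le d(H(x),H(y))\le K\,d(x,y)$ for all $x,y$) and a homeomorphism $h:\mathbf{S}\to\mathbf{S}$ which extends $H$ continuously, such that for some nice lattices $\Gamma_1,\Gamma_2$ one has both $H\Gamma_1H^{-1}=\Gamma_2$ on $\mathbf{H}^3$ and $h\Gamma_1h^{-1}=\Gamma_2$ on $\mathbf{S}$. **Theorem.** Let $(H,h)$ be an equivariant pair with $h(\infty)=\infty$, and regard $h$ as a homeomorphism of $\mathbb{C}$.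 Then $h$ has an *asterisk*: there is a point $z\in\mathbb{C}$ such that for every $v\in\mathbb{C}$ with rational real and imaginary parts the directional derivative $$D_vh(z)=\lim_{t\to 0,\ t\in\mathbb{R}}\frac{h(z+vt)-h(z)}{t}$$ exists, and $D_1h(z)\neq 0$. -/

import Mathlib

open Topology Filter

noncomputable section

/-- The upper half space `ℂ × (0, ∞)`. -/
@[ext]
structure H3 where
  z : ℂ
  t : ℝ
  t_pos : 0 < t

namespace H3

/-- The point `(z, t)` of Euclidean `ℂ × ℝ`. -/
def toEuclidean (p : H3) : WithLp 2 (ℂ × ℝ) := WithLp.toLp 2 (p.z, p.t)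

/-- The mirror image `(z, -t)` in Euclidean `ℂ × ℝ`. -/
def mirror (p : H3) : WithLp 2 (ℂ × ℝ) := WithLp.toLp 2 (p.z, -p.t)

/-- The hyperbolic distance of curvature `-1`: `sinh (d/2) = |p - q| / (2 √(t s))`, where `|p - q|`
is the Euclidean distance and `t`, `s` are the heights. -/
instance : Dist H3 :=
  ⟨fun p q => 2 * Real.arsinh (dist p.toEuclidean q.toEuclidean / (2 * √(p.t * q.t)))⟩

theorem dist_eq (p q : H3) :
    dist p q = 2 * Real.arsinh (dist p.toEuclidean q.toEuclidean / (2 * √(p.t * q.t))) := rfl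

theorem euclidean_dist_sq (p q : H3) :
    dist p.toEuclidean q.toEuclidean ^ 2 = ‖p.z - q.z‖ ^ 2 + (p.t - q.t) ^ 2 := by
  rw [WithLp.prod_dist_eq_of_L2, Real.sq_sqrt (by positivity)]
  simp [toEuclidean, Complex.dist_eq, Real.dist_eq]

theorem mirror_dist_sq (p q : H3) :
    dist p.toEuclidean q.mirror ^ 2 = ‖p.z - q.z‖ ^ 2 + (p.t + q.t) ^ 2 := by
  rw [WithLp.prod_dist_eq_of_L2, Real.sq_sqrt (by positivity)]
  simp [toEuclidean, mirror, Complex.dist_eq, Real.dist_eq]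

theorem mirror_dist_comm (p q : H3) :
    dist p.toEuclidean q.mirror = dist q.toEuclidean p.mirror := by
  rw [← sq_eq_sq₀ dist_nonneg dist_nonneg, mirror_dist_sq, mirror_dist_sq, norm_sub_rev, add_comm p.t]

theorem mirror_dist_self (p : H3) : dist p.toEuclidean p.mirror = 2 * p.t := by
  rw [← sq_eq_sq₀ dist_nonneg (by linarith [p.t_pos]), mirror_dist_sq]
  simp
  ring

theorem sinh_half_dist (p q : H3) :
    Real.sinh (dist p q / 2) = dist p.toEuclidean q.toEuclidean / (2 * √(p.t * q.t)) := by
  rw [dist_eq, mul_div_cancel_left₀ _ two_ne_zero, Real.sinh_arsinh]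

theorem cosh_half_dist (p q : H3) :
    Real.cosh (dist p q / 2) = dist p.toEuclidean q.mirror / (2 * √(p.t * q.t)) := by
  have hp := p.t_pos
  have hq := q.t_pos
  have hpq : 0 < p.t * q.t := mul_pos hp hq
  rw [← sq_eq_sq₀ (Real.cosh_pos _).le (by positivity), Real.cosh_sq', sinh_half_dist, div_pow,
    div_pow, mul_pow, Real.sq_sqrt hpq.le, euclidean_dist_sq, mirror_dist_sq]
  field_simp
  ring

protected theorem dist_triangle (a b c : H3) : dist a c ≤ dist a b + dist b c := by
  have ha := a.t_pos
  have hb := b.t_pos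
  have hc := c.t_pos
  have key := EuclideanGeometry.mul_dist_le_mul_dist_add_mul_dist
    a.toEuclidean b.toEuclidean c.toEuclidean b.mirror
  rw [mirror_dist_self] at key
  suffices h : dist a c / 2 ≤ dist a b / 2 + dist b c / 2 by linarith
  rw [← Real.sinh_le_sinh, Real.sinh_add, sinh_half_dist, sinh_half_dist, sinh_half_dist,
    cosh_half_dist, cosh_half_dist, mirror_dist_comm b c, Real.sqrt_mul ha.le, Real.sqrt_mul ha.le,
    Real.sqrt_mul hb.le]
  have sa : 0 < √a.t := Real.sqrt_pos.2 ha
  have sb : 0 < √b.t := Real.sqrt_pos.2 hb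
  have sc : 0 < √c.t := Real.sqrt_pos.2 hc
  have hbb : √b.t * √b.t = b.t := Real.mul_self_sqrt hb.le
  rw [div_mul_div_comm, div_mul_div_comm, ← add_div, div_le_div_iff₀ (by positivity) (by positivity)]
  calc _ = (dist a.toEuclidean c.toEuclidean * (2 * (√b.t * √b.t))) * (2 * (√a.t * √c.t)) := by ring
    _ ≤ (dist a.toEuclidean b.toEuclidean * dist c.toEuclidean b.mirror +
          dist b.toEuclidean c.toEuclidean * dist a.toEuclidean b.mirror) *
            (2 * (√a.t * √c.t)) := by rw [hbb]; gcongr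
    _ = _ := by ring

/-- Hyperbolic 3-space. -/
instance : MetricSpace H3 where
  dist_self p := by simp [dist_eq]
  dist_comm p q := by rw [dist_eq, dist_eq, dist_comm, mul_comm p.t]
  dist_triangle := H3.dist_triangle
  eq_of_dist_eq_zero {p q} h := by
    have hpq : √(p.t * q.t) ≠ 0 := (Real.sqrt_pos.2 (mul_pos p.t_pos q.t_pos)).ne'
    have h0 : dist p.toEuclidean q.toEuclidean = 0 := by
      simpa [dist_eq, hpq] using h
    have h1 : p.toEuclidean = q.toEuclidean := dist_eq_zero.1 h0
    simp only [toEuclidean, WithLp.toLp.injEq, Prod.mk.injEq] at h1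
    exact H3.ext h1.1 h1.2

/-- The group of all isometries acts on hyperbolic 3-space by evaluation. -/
instance : MulAction (H3 ≃ᵢ H3) H3 where
  smul g p := g p
  one_smul _ := rfl
  mul_smul _ _ _ := rfl

end H3

/-- The Riemann sphere `ℂ ∪ {∞}`. -/
abbrev Sphere : Type := OnePoint ℂ

/-- Hyperbolic 3-space together with its ideal boundary. -/
inductive ClosedH3 : Type
  | inner (p : H3) : ClosedH3
  | ideal (x : Sphere) : ClosedH3

namespace ClosedH3

/-- The inclusion into the one-point compactification of `ℂ × ℝ`: an inner point goes to `(z, t)`,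
an ideal point `z` to `(z, 0)` and the ideal point `∞` to `∞`. -/
def toOnePoint : ClosedH3 → OnePoint (ℂ × ℝ)
  | inner p => ((p.z, p.t) : ℂ × ℝ)
  | ideal x => OnePoint.map (fun z : ℂ => ((z, 0) : ℂ × ℝ)) x

/-- The topology of the closed upper half space with `∞` added (a closed ball). -/
instance : TopologicalSpace ClosedH3 :=
  TopologicalSpace.induced toOnePoint inferInstance

/-- The self-map that is `H` inside and `h` on the ideal boundary. -/
def glue (H : H3 → H3) (h : Sphere → Sphere) : ClosedH3 → ClosedH3
  | inner p => inner (H p)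
  | ideal x => ideal (h x)

end ClosedH3

/-- `h` is a continuous extension of `H` to the Riemann sphere. -/
def IsBoundaryExtension (H : H3 → H3) (h : Sphere → Sphere) : Prop :=
  Continuous (ClosedH3.glue H h)

/-- Bi-Lipschitz bijections. -/
def IsBL {X Y : Type*} [MetricSpace X] [MetricSpace Y] (H : X → Y) : Prop :=
  Function.Bijective H ∧ ∃ K : ℝ, 1 ≤ K ∧
    ∀ x y : X, K⁻¹ * dist x y ≤ dist (H x) (H y) ∧ dist (H x) (H y) ≤ K * dist x y

/-- A nice lattice: the projection from hyperbolic 3-space to the orbit space of `Γ` is a covering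
map with deck group `Γ`, and the orbit space is compact. -/
structure IsNiceLattice (Γ : Subgroup (H3 ≃ᵢ H3)) : Prop where
  covering : IsQuotientCoveringMap (Quotient.mk (MulAction.orbitRel Γ H3)) Γ
  compact : CompactSpace (Quotient (MulAction.orbitRel Γ H3))

/-- The homeomorphisms of the sphere by which the elements of `Γ` act on the ideal boundary. -/
def boundaryAction (Γ : Subgroup (H3 ≃ᵢ H3)) : Set (Sphere ≃ₜ Sphere) :=
  {g | ∃ γ ∈ Γ, IsBoundaryExtension γ g}

/-- A bi-Lipschitz `H` and a continuous extension `h` of it to the sphere which are both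
equivariant with respect to the same pair of nice lattices: `H Γ₁ H⁻¹ = Γ₂`, `h Γ₁ h⁻¹ = Γ₂`. -/
structure IsEquivariantPair (H : Equiv.Perm H3) (h : Sphere ≃ₜ Sphere) : Prop where
  bl : IsBL H
  ext : IsBoundaryExtension H h
  equivariant : ∃ Γ₁ Γ₂ : Subgroup (H3 ≃ᵢ H3), IsNiceLattice Γ₁ ∧ IsNiceLattice Γ₂ ∧
    (fun γ : H3 ≃ᵢ H3 => H * γ.toEquiv * H⁻¹) '' (Γ₁ : Set (H3 ≃ᵢ H3)) =
      IsometryEquiv.toEquiv '' (Γ₂ : Set (H3 ≃ᵢ H3)) ∧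
    (fun g : Sphere ≃ₜ Sphere => h * g * h⁻¹) '' boundaryAction Γ₁ = boundaryAction Γ₂

theorem exists_finite_value (h : Sphere ≃ₜ Sphere) (hinf : h OnePoint.infty = OnePoint.infty)
    (z : ℂ) : ∃ w : ℂ, (w : Sphere) = h (z : Sphere) :=
  OnePoint.ne_infty_iff_exists.1 fun hz =>
    OnePoint.coe_ne_infty z (h.injective (hz.trans hinf.symm))

/-- A homeomorphism of the sphere that fixes `∞`, interpreted as a map of `ℂ`. -/
def planeMap (h : Sphere ≃ₜ Sphere) (hinf : h OnePoint.infty = OnePoint.infty) (z : ℂ) : ℂ :=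
  Classical.choose (exists_finite_value h hinf z)

theorem coe_planeMap (h : Sphere ≃ₜ Sphere) (hinf : h OnePoint.infty = OnePoint.infty) (z : ℂ) :
    (planeMap h hinf z : Sphere) = h (z : Sphere) :=
  Classical.choose_spec (exists_finite_value h hinf z)

/-- `z` is an asterisk for `f`: every directional derivative of `f` at `z` in a direction `a + b i`
with `a`, `b` rational exists, and the one in the direction `1` is not zero. -/
def IsAsterisk (f : ℂ → ℂ) (z : ℂ) : Prop :=
  (∀ a b : ℚ, LineDifferentiableAt ℝ f z ⟨(a : ℝ), (b : ℝ)⟩) ∧ lineDeriv ℝ f z 1 ≠ 0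

end

/-! Two facts carry the proof: `h` is weakly quasisymmetric on the plane, and a weakly
quasisymmetric homeomorphism of the plane has an asterisk.

Quasisymmetry comes from compactness. A homeomorphism of the closed ball keeps uniformly separated
pairs uniformly separated. If two pairs are separated as seen from some point `o`, cocompactness
gives a lattice element carrying `o` near the base point, and equivariance turns this motion into an
isometry of the target, which leaves cross ratios unchanged. So one constant bounds the cross ratio
of the images in every such configuration (`exists_chord_mul_chord_le`). Letting the four points
tend to `z`, `w₁`, `w₂`, `∞`, seen from the point at height `|w₂ - z|` above `z`, gives the
quasisymmetry inequality.

The second fact is Gehring's length-area argument. The squared diameter of the image of a disc is at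
most a constant times its area. Chains of small discs along a vertical line, with Cauchy-Schwarz and
the a.e. finite density of image area, make `f` absolutely continuous on almost every line. Hence
each directional derivative exists almost everywhere. It cannot vanish almost everywhere, since then
`f` would be constant on a segment. Countably many rational directions have a common set of full
measure. -/

open MeasureTheory Set

/-! ### Length-area estimates and absolute continuity on lines -/

/-- A map for which the image of a point in a ball is at most `K` times as far from the image of the
centre as the image of a point outside the ball. -/
def WeaklyQuasisymmetric (K : ℝ) (f : ℂ → ℂ) : Prop :=
  ∀ z w₁ w₂, dist w₁ z ≤ dist w₂ z → dist (f w₁) (f z) ≤ K * dist (f w₂) (f z)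

/-- The measure `S ↦ area (f S)`. -/
noncomputable def imageArea (f : ℂ ≃ₜ ℂ) : Measure ℂ := volume.map f.symm

theorem imageArea_lt_top (f : ℂ ≃ₜ ℂ) {s : Set ℂ} (hs : Bornology.IsBounded s) :
    imageArea f s < ⊤ := by
  have hc : IsCompact (closure s) := hs.isCompact_closure
  refine (measure_mono subset_closure).trans_lt ?_
  rw [imageArea, Measure.map_apply f.symm.continuous.measurable isClosed_closure.measurableSet,
    ← f.image_eq_preimage_symm]
  exact (hc.image f.continuous).measure_lt_top

/-- With `l = |f (c + r) - f c|`, the image of the closed disc lies within `K * l` of `f c`, while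
the image of the open disc contains the disc of radius `l / K`. The constant is `(2 * K * l) ^ 2`
divided by `π * (l / K) ^ 2`. -/
theorem WeaklyQuasisymmetric.dist_sq_le_imageArea_ball {K : ℝ} (hK : 0 < K) {f : ℂ ≃ₜ ℂ}
    (hf : WeaklyQuasisymmetric K f) {c a b : ℂ} {r : ℝ} (hr : 0 < r) (ha : dist a c ≤ r)
    (hb : dist b c ≤ r) :
    dist (f a) (f b) ^ 2 ≤ 4 * K ^ 4 / Real.pi * (imageArea f).real (Metric.ball c r) := by
  have hp : dist (c + r) c = r := by simp [dist_eq_norm, hr.le]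
  set l := dist (f (c + r)) (f c) with hl
  have h1 : dist (f a) (f b) ≤ 2 * (K * l) := by
    have h2 := hf c a (c + r) (by rwa [hp])
    have h3 := hf c b (c + r) (by rwa [hp])
    linarith [dist_triangle_right (f a) (f b) (f c)]
  have h4 : Metric.ball (f c) (l / K) ⊆ f.symm ⁻¹' Metric.ball c r := by
    intro u hu
    by_contra hw
    simp only [mem_preimage, Metric.mem_ball, not_lt] at hw hu
    have := hf c (c + r) (f.symm u) (by rwa [hp])
    rw [f.apply_symm_apply, ← hl] at this
    rw [lt_div_iff₀ hK] at hu
    linarith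
  have h5 : Real.pi * (l / K) ^ 2 ≤ (imageArea f).real (Metric.ball c r) := by
    have h6 : imageArea f (Metric.ball c r) ≠ ⊤ :=
      (imageArea_lt_top f Metric.isBounded_ball).ne
    rw [Measure.real, ← ENNReal.ofReal_le_iff_le_toReal h6]
    have h7 : volume (Metric.ball (f c) (l / K)) ≤ imageArea f (Metric.ball c r) := by
      rw [imageArea, Measure.map_apply f.symm.continuous.measurable measurableSet_ball]
      exact measure_mono h4
    refine le_trans (le_of_eq ?_) h7
    have hlk : 0 ≤ l / K := by positivity
    rw [Complex.volume_ball, mul_comm, ENNReal.ofReal_mul (by positivity), ENNReal.ofReal_pow hlk]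
    congr 1
    rw [← NNReal.coe_real_pi, ENNReal.ofReal_coe_nnreal]
  calc dist (f a) (f b) ^ 2 ≤ (2 * (K * l)) ^ 2 := by gcongr
    _ = 4 * K ^ 4 / Real.pi * (Real.pi * (l / K) ^ 2) := by
      field_simp
      ring
    _ ≤ _ := by gcongr

/-- The segment is covered by a stack of discs of diameter at most `r`, whose open discs are
disjoint and lie in the strip. The disc estimate and Cauchy-Schwarz then cost a factor equal to the
number of discs. -/
theorem WeaklyQuasisymmetric.dist_sq_le_imageArea_strip {K : ℝ} (hK : 0 < K) {f : ℂ ≃ₜ ℂ}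
    (hf : WeaklyQuasisymmetric K f) (x : ℝ) {a b r : ℝ} (hab : a < b) (hr : 0 < r)
    (hrab : r ≤ b - a) :
    dist (f ⟨x, a⟩) (f ⟨x, b⟩) ^ 2 ≤ 8 * K ^ 4 / Real.pi * ((b - a) / r) *
      (imageArea f).real (Icc (x - r) (x + r) ×ℂ Ioc a b) := by
  set n := ⌈(b - a) / r⌉₊ with hn
  have hn0 : 0 < n := Nat.ceil_pos.2 (div_pos (sub_pos.2 hab) hr)
  have hn0' : (0 : ℝ) < n := by exact_mod_cast hn0
  set s := (b - a) / n with hs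
  have hs0 : 0 < s := div_pos (sub_pos.2 hab) hn0'
  have hns : n * s = b - a := by rw [hs]; field_simp
  have hsr : s ≤ r := by
    rw [hs, div_le_iff₀ hn0', mul_comm, ← div_le_iff₀ hr]
    exact Nat.le_ceil _
  -- Since `r ≤ b - a`, rounding up at most doubles the quotient.
  have hn2 : (n : ℝ) ≤ 2 * ((b - a) / r) := by
    have h1 : (n : ℝ) < (b - a) / r + 1 := Nat.ceil_lt_add_one (by positivity)
    have h2 : 1 ≤ (b - a) / r := (one_le_div hr).2 hrab
    linarith
  let p : ℕ → ℂ := fun j => ⟨x, a + j * s⟩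
  let c : ℕ → ℂ := fun j => ⟨x, a + (j + 1 / 2) * s⟩
  have hpn : p n = ⟨x, b⟩ := by simp [p, hns]
  have hp0 : p 0 = ⟨x, a⟩ := by simp [p]
  have hvert : ∀ u v : ℝ, dist (⟨x, u⟩ : ℂ) ⟨x, v⟩ = |u - v| := fun u v => by
    rw [Complex.dist_of_re_eq (z := ⟨x, u⟩) (w := ⟨x, v⟩) rfl, Real.dist_eq]
  have hball : ∀ j < n, Metric.ball (c j) (s / 2) ⊆ Icc (x - r) (x + r) ×ℂ Ioc a b ∩
      {w | a + j * s < w.im ∧ w.im < a + (j + 1) * s} := by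
    intro j hj w hw
    rw [Metric.mem_ball, dist_eq_norm] at hw
    have h1 := abs_le.1 ((Complex.abs_re_le_norm (w - c j)).trans hw.le)
    have h2 := abs_lt.1 ((Complex.abs_im_le_norm (w - c j)).trans_lt hw)
    simp only [Complex.sub_re, Complex.sub_im, c] at h1 h2
    have h3 : ((j : ℝ) + 1) * s ≤ n * s := by
      gcongr
      exact_mod_cast hj
    have h4 : 0 ≤ (j : ℝ) * s := by positivity
    refine ⟨⟨⟨?_, ?_⟩, ?_, ?_⟩, ?_, ?_⟩ <;> linarith
  have hdisj : (Finset.range n : Set ℕ).PairwiseDisjoint fun j => Metric.ball (c j) (s / 2) := by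
    have key : ∀ i j : ℕ, i < n → j < n → i < j →
        Disjoint (Metric.ball (c i) (s / 2)) (Metric.ball (c j) (s / 2)) := by
      intro i j hi hj hij
      rw [Set.disjoint_left]
      intro w hwi hwj
      have h1 := (hball i hi hwi).2.2
      have h2 := (hball j hj hwj).2.1
      have h3 : ((i : ℝ) + 1) * s ≤ j * s := by
        gcongr
        exact_mod_cast hij
      linarith
    intro i hi j hj hij
    rcases lt_or_gt_of_ne hij with h | h
    · exact key i j (by simpa using hi) (by simpa using hj) h
    · exact (key j i (by simpa using hj) (by simpa using hi) h).symm
  have hfin : imageArea f (Icc (x - r) (x + r) ×ℂ Ioc a b) ≠ ⊤ :=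
    (imageArea_lt_top f (Metric.isBounded_Icc _ _ |>.reProdIm (Metric.isBounded_Ioc _ _))).ne
  have hsum : ∑ j ∈ Finset.range n, (imageArea f).real (Metric.ball (c j) (s / 2)) ≤
      (imageArea f).real (Icc (x - r) (x + r) ×ℂ Ioc a b) := by
    rw [← measureReal_biUnion_finset hdisj (fun _ _ => measurableSet_ball)
      (fun _ _ => (imageArea_lt_top f Metric.isBounded_ball).ne)]
    refine measureReal_mono ?_ hfin
    exact iUnion₂_subset fun j hj => (hball j (Finset.mem_range.1 hj)).trans inter_subset_left
  have hstep : ∀ j, dist (f (p j)) (f (p (j + 1))) ^ 2 ≤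
      4 * K ^ 4 / Real.pi * (imageArea f).real (Metric.ball (c j) (s / 2)) := by
    intro j
    apply hf.dist_sq_le_imageArea_ball hK (by positivity)
    · rw [hvert, abs_le]; constructor <;> linarith
    · rw [hvert, abs_le]; push_cast; constructor <;> linarith
  calc dist (f ⟨x, a⟩) (f ⟨x, b⟩) ^ 2
      ≤ (∑ j ∈ Finset.range n, dist (f (p j)) (f (p (j + 1)))) ^ 2 := by
        rw [← hpn, ← hp0]
        gcongr
        exact dist_le_range_sum_dist (fun j => f (p j)) n
    _ ≤ n * ∑ j ∈ Finset.range n, dist (f (p j)) (f (p (j + 1))) ^ 2 := by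
        simpa using sq_sum_le_card_mul_sum_sq (s := Finset.range n)
          (f := fun j => dist (f (p j)) (f (p (j + 1))))
    _ ≤ (2 * ((b - a) / r)) * ∑ j ∈ Finset.range n,
          4 * K ^ 4 / Real.pi * (imageArea f).real (Metric.ball (c j) (s / 2)) := by
        gcongr with j hj
        exact hstep j
    _ ≤ (2 * ((b - a) / r)) *
          (4 * K ^ 4 / Real.pi * (imageArea f).real (Icc (x - r) (x + r) ×ℂ Ioc a b)) := by
        rw [← Finset.mul_sum]
        gcongr
    _ = _ := by ring

theorem WeaklyQuasisymmetric.dist_sq_le_imageArea_uIoc {K : ℝ} (hK : 0 < K) {f : ℂ ≃ₜ ℂ}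
    (hf : WeaklyQuasisymmetric K f) (x a b : ℝ) {r : ℝ} (hr : 0 < r)
    (hrab : a ≠ b → r ≤ dist a b) :
    dist (f ⟨x, a⟩) (f ⟨x, b⟩) ^ 2 ≤ dist a b * (8 * K ^ 4 / Real.pi / r *
      (imageArea f).real (Icc (x - r) (x + r) ×ℂ uIoc a b)) := by
  rcases lt_trichotomy a b with h | rfl | h
  · have h1 : dist a b = b - a := by rw [dist_comm, Real.dist_eq, abs_of_pos (sub_pos.2 h)]
    rw [uIoc_of_le h.le, h1]
    exact (hf.dist_sq_le_imageArea_strip hK x h hr (h1 ▸ hrab h.ne)).trans_eq (by ring)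
  · simp
  · have h1 : dist a b = a - b := by rw [Real.dist_eq, abs_of_pos (sub_pos.2 h)]
    rw [uIoc_of_ge h.le, h1, dist_comm]
    exact (hf.dist_sq_le_imageArea_strip hK x h hr (h1 ▸ hrab h.ne')).trans_eq (by ring)

/-- The area of the image, projected to the real axis, is a locally finite measure; its density with
respect to Lebesgue measure is finite almost everywhere, even if there is a singular part. -/
theorem ae_eventually_imageArea_strip_le (f : ℂ ≃ₜ ℂ) (R : ℝ) :
    ∀ᵐ x : ℝ, ∃ M : ℝ, 0 ≤ M ∧ ∀ᶠ r in 𝓝[>] (0 : ℝ),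
      (imageArea f).real (Icc (x - r) (x + r) ×ℂ Icc (-R) R) ≤ M * r := by
  let ν : Measure ℝ := ((imageArea f).restrict (Complex.im ⁻¹' Icc (-R) R)).map Complex.re
  have hν : ∀ s, MeasurableSet s → ν s = imageArea f (s ×ℂ Icc (-R) R) := fun s hs => by
    rw [Measure.map_apply Complex.measurable_re hs,
      Measure.restrict_apply (Complex.measurable_re hs)]
    rfl
  have hfin : ∀ x r, ν (Icc (x - r) (x + r)) < ⊤ := fun x r => by
    rw [hν _ measurableSet_Icc]
    exact imageArea_lt_top f (Metric.isBounded_Icc _ _ |>.reProdIm (Metric.isBounded_Icc _ _))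
  have : IsLocallyFiniteMeasure ν :=
    ⟨fun x => ⟨Icc (x - 1) (x + 1), Icc_mem_nhds (by linarith) (by linarith), hfin x 1⟩⟩
  filter_upwards [Besicovitch.ae_tendsto_rnDeriv ν volume, ν.rnDeriv_lt_top volume] with x hx hx'
  obtain ⟨M, hM, -⟩ := ENNReal.lt_iff_exists_nnreal_btwn.1 hx'
  refine ⟨2 * M, by positivity, ?_⟩
  filter_upwards [hx.eventually_lt_const hM, self_mem_nhdsWithin] with r hr hr0
  have hr0 : 0 < r := hr0
  rw [Real.closedBall_eq_Icc, Real.volume_Icc, hν _ measurableSet_Icc,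
    ENNReal.div_lt_iff (Or.inl (by simpa using hr0)) (Or.inl ENNReal.ofReal_ne_top)] at hr
  have := ENNReal.toReal_mono (by finiteness) hr.le
  rw [ENNReal.toReal_mul, ENNReal.toReal_ofReal (by linarith)] at this
  calc _ ≤ _ := this
    _ = _ := by simp; ring

theorem WeaklyQuasisymmetric.ae_absolutelyContinuousOnInterval {K : ℝ} (hK : 0 < K) {f : ℂ ≃ₜ ℂ}
    (hf : WeaklyQuasisymmetric K f) (R : ℝ) (hR : 0 ≤ R) :
    ∀ᵐ x : ℝ, AbsolutelyContinuousOnInterval (fun y : ℝ => f ⟨x, y⟩) (-R) R := by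
  filter_upwards [ae_eventually_imageArea_strip_le f R] with x ⟨M, hM0, hM⟩
  rw [absolutelyContinuousOnInterval_iff]
  intro ε hε
  set C := 8 * K ^ 4 / Real.pi with hC
  have hC0 : 0 ≤ C := by positivity
  -- The summand `1` keeps the denominator positive when `C * M = 0`.
  refine ⟨ε ^ 2 / (C * M + 1), by positivity, ?_⟩
  rintro ⟨n, I⟩ hE hlen
  dsimp only at hlen ⊢
  have hsmall : ∀ᶠ r in 𝓝[>] (0 : ℝ), ∀ i ∈ Finset.range n, (I i).1 ≠ (I i).2 →
      r ≤ dist (I i).1 (I i).2 := by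
    rw [Filter.eventually_all_finset]
    intro i _
    by_cases h : (I i).1 = (I i).2
    · simp [h]
    · filter_upwards [Ioo_mem_nhdsGT (dist_pos.2 h)] with r hr _
      exact hr.2.le
  -- The width `r` may depend on the intervals, because it cancels between `C / r` and `M * r`; `δ`
  -- does not depend on it.
  obtain ⟨r, hrM, hrI, hr⟩ := (hM.and (hsmall.and self_mem_nhdsWithin)).exists
  have hr : 0 < r := hr
  have hbdd : ∀ a b : ℝ, Bornology.IsBounded (Icc (x - r) (x + r) ×ℂ uIoc a b) := fun a b =>
    Metric.isBounded_Icc _ _ |>.reProdIm (Metric.isBounded_Ioc _ _)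
  have hsum : ∑ i ∈ Finset.range n,
      (imageArea f).real (Icc (x - r) (x + r) ×ℂ uIoc (I i).1 (I i).2) ≤ M * r := by
    refine le_trans ?_ hrM
    rw [← measureReal_biUnion_finset ?_ ?_ fun i _ => (imageArea_lt_top f (hbdd _ _)).ne]
    · refine measureReal_mono ?_ (imageArea_lt_top f
        (Metric.isBounded_Icc _ _ |>.reProdIm (Metric.isBounded_Icc _ _))).ne
      refine iUnion₂_subset fun i hi => ?_
      refine inter_subset_inter_right _ (preimage_mono ?_)
      refine (AbsolutelyContinuousOnInterval.uIoc_subset_of_mem_disjWithin hE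
        (Finset.mem_range.1 hi)).trans ?_
      rw [uIoc_of_le (by linarith)]
      exact Ioc_subset_Icc_self
    · intro i hi j hj hij
      exact ((hE.2 hi hj hij).preimage Complex.im).mono inter_subset_right inter_subset_right
    · intro i _
      exact (Complex.measurable_re measurableSet_Icc).inter
        (Complex.measurable_im measurableSet_uIoc)
  have hsq : (∑ i ∈ Finset.range n, dist (f ⟨x, (I i).1⟩) (f ⟨x, (I i).2⟩)) ^ 2 < ε ^ 2 :=
    calc _ ≤ (∑ i ∈ Finset.range n, dist (I i).1 (I i).2) *
          ∑ i ∈ Finset.range n,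
            C / r * (imageArea f).real (Icc (x - r) (x + r) ×ℂ uIoc (I i).1 (I i).2) := by
          refine Finset.sum_sq_le_sum_mul_sum_of_sq_le_mul _ (fun _ _ => dist_nonneg)
            (fun _ _ => by positivity) fun i hi => ?_
          exact hf.dist_sq_le_imageArea_uIoc hK x _ _ hr (hrI i hi)
      _ ≤ (∑ i ∈ Finset.range n, dist (I i).1 (I i).2) * (C / r * (M * r)) := by
          rw [← Finset.mul_sum]
          gcongr
      _ = (∑ i ∈ Finset.range n, dist (I i).1 (I i).2) * (C * M) := by field_simp
      _ ≤ (∑ i ∈ Finset.range n, dist (I i).1 (I i).2) * (C * M + 1) := by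
          gcongr
          linarith
      _ < ε ^ 2 := by rwa [← lt_div_iff₀ (by positivity)]
  exact lt_of_pow_lt_pow_left₀ 2 hε.le hsq

/-! ### Directional derivatives almost everywhere -/

theorem hasLineDerivAt_I_iff {f : ℂ → ℂ} {f' : ℂ} {x y : ℝ} :
    HasLineDerivAt ℝ f f' ⟨x, y⟩ Complex.I ↔ HasDerivAt (fun y : ℝ => f ⟨x, y⟩) f' y := by
  have h : (fun t : ℝ => f (⟨x, y⟩ + t • Complex.I)) = fun t : ℝ => f ⟨x, y + t⟩ := by
    funext t
    congr 1
    apply Complex.ext <;> simp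
  rw [HasLineDerivAt, h]
  constructor
  · intro h
    simpa using HasDerivAt.comp_sub_const (f := fun t : ℝ => f ⟨x, y + t⟩) y y (by simpa using h)
  · intro h
    exact HasDerivAt.comp_const_add y 0 (f := fun y : ℝ => f ⟨x, y⟩) (by simpa using h)

theorem ae_complex_of_ae_ae {s : Set ℂ} (hs : MeasurableSet s)
    (h : ∀ᵐ x : ℝ, ∀ᵐ y : ℝ, (⟨x, y⟩ : ℂ) ∈ s) : ∀ᵐ z : ℂ, z ∈ s := by
  have h1 : ∀ᵐ p : ℝ × ℝ, p ∈ Complex.measurableEquivRealProd.symm ⁻¹' s :=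
    (Measure.ae_prod_mem_iff_ae_ae_mem (Complex.measurableEquivRealProd.symm.measurable hs)).2 h
  exact Complex.volume_preserving_equiv_real_prod.quasiMeasurePreserving.ae h1

theorem ae_ae_of_ae_complex {p : ℂ → Prop} (h : ∀ᵐ z : ℂ, p z) :
    ∀ᵐ x : ℝ, ∀ᵐ y : ℝ, p ⟨x, y⟩ :=
  Measure.ae_ae_of_ae_prod
    (Complex.volume_preserving_equiv_real_prod.symm.quasiMeasurePreserving.ae h)

theorem WeaklyQuasisymmetric.ae_lineDifferentiableAt_I {K : ℝ} (hK : 0 < K) {f : ℂ ≃ₜ ℂ}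
    (hf : WeaklyQuasisymmetric K f) : ∀ᵐ z, LineDifferentiableAt ℝ f z Complex.I := by
  refine ae_complex_of_ae_ae (measurableSet_lineDifferentiableAt f.continuous) ?_
  have h : ∀ᵐ x : ℝ, ∀ n : ℕ, AbsolutelyContinuousOnInterval (fun y : ℝ => f ⟨x, y⟩) (-n) n :=
    ae_all_iff.2 fun n => hf.ae_absolutelyContinuousOnInterval hK n n.cast_nonneg
  filter_upwards [h] with x hx
  have h' : ∀ᵐ y : ℝ, ∀ n : ℕ, y ∈ uIcc (-n : ℝ) n →
      DifferentiableAt ℝ (fun y : ℝ => f ⟨x, y⟩) y :=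
    ae_all_iff.2 fun n => (hx n).boundedVariationOn.ae_differentiableAt_of_mem_uIcc
  filter_upwards [h'] with y hy
  obtain ⟨n, hn⟩ := exists_nat_ge |y|
  have hyn : y ∈ uIcc (-n : ℝ) n := by
    rw [uIcc_of_le (by linarith [abs_nonneg y])]
    exact abs_le.1 hn
  exact (hasLineDerivAt_I_iff.2 (hy n hyn).hasDerivAt).lineDifferentiableAt

/-- Otherwise Fubini yields a vertical segment on which `f` is absolutely continuous with derivative
zero almost everywhere, hence constant, against injectivity. -/
theorem WeaklyQuasisymmetric.not_ae_hasLineDerivAt_I_zero {K : ℝ} (hK : 0 < K) {f : ℂ ≃ₜ ℂ}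
    (hf : WeaklyQuasisymmetric K f) : ¬ ∀ᵐ z, HasLineDerivAt ℝ f 0 z Complex.I := by
  intro h
  obtain ⟨x, hx, hac⟩ := ((ae_ae_of_ae_complex h).and
    (hf.ae_absolutelyContinuousOnInterval hK 1 zero_le_one)).exists
  obtain ⟨C, hC⟩ := hac.const_of_ae_hasDerivAt_zero (by
    filter_upwards [hx] with y hy _
    exact hasLineDerivAt_I_iff.1 hy)
  have := f.injective ((hC (-1) (by simp)).trans (hC 1 (by simp)).symm)
  have := congrArg Complex.im this
  norm_num at this

theorem Complex.quasiMeasurePreserving_mul {c : ℂ} (hc : c ≠ 0) :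
    Measure.QuasiMeasurePreserving (fun z => c * z) (volume : Measure ℂ) volume := by
  refine ⟨measurable_const_mul c, ?_⟩
  have h := Measure.map_linearMap_addHaar_eq_smul_addHaar (volume : Measure ℂ)
    (f := LinearMap.mulLeft ℝ c) (fun h0 => by
      have h1 : LinearMap.mulLeft ℝ c * LinearMap.mulLeft ℝ c⁻¹ = 1 := by
        ext; simp [hc]
      have h2 := congrArg LinearMap.det h1
      rw [map_mul, h0, zero_mul, map_one] at h2
      exact zero_ne_one h2)
  have h' : Measure.map (fun z => c * z) (volume : Measure ℂ) = _ := h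
  rw [h']
  exact Measure.smul_absolutelyContinuous

theorem WeaklyQuasisymmetric.comp_mulLeft {K : ℝ} {f : ℂ ≃ₜ ℂ} (hf : WeaklyQuasisymmetric K f)
    {c : ℂ} (hc : c ≠ 0) : WeaklyQuasisymmetric K ((Homeomorph.mulLeft₀ c hc).trans f) := by
  intro z w₁ w₂ h
  refine hf _ _ _ ?_
  change dist (c * w₁) (c * z) ≤ dist (c * w₂) (c * z)
  rw [dist_eq_norm, dist_eq_norm] at h ⊢
  rw [← mul_sub, ← mul_sub, norm_mul, norm_mul]
  gcongr

theorem hasLineDerivAt_comp_mulLeft {f : ℂ → ℂ} {c z v f' : ℂ} :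
    HasLineDerivAt ℝ (fun w => f (c * w)) f' z v ↔ HasLineDerivAt ℝ f f' (c * z) (c * v) := by
  simp only [HasLineDerivAt, mul_add, mul_smul_comm]

theorem WeaklyQuasisymmetric.ae_lineDifferentiableAt {K : ℝ} (hK : 0 < K) {f : ℂ ≃ₜ ℂ}
    (hf : WeaklyQuasisymmetric K f) (v : ℂ) : ∀ᵐ z, LineDifferentiableAt ℝ f z v := by
  rcases eq_or_ne v 0 with rfl | hv
  · exact Eventually.of_forall fun z => lineDifferentiableAt_zero
  -- Multiplication by `-I * v` takes the direction `I` to `v`, which reduces the claim to vertical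
  -- lines.
  have hc : -Complex.I * v ≠ 0 := by simp [hv]
  have h1 := (hf.comp_mulLeft hc).ae_lineDifferentiableAt_I hK
  filter_upwards [(Complex.quasiMeasurePreserving_mul (inv_ne_zero hc)).ae h1] with z hz
  have h2 := (hasLineDerivAt_comp_mulLeft (f := f) (c := -Complex.I * v)).1 hz.hasLineDerivAt
  rw [mul_inv_cancel_left₀ hc, mul_right_comm] at h2
  simpa using h2.lineDifferentiableAt

theorem WeaklyQuasisymmetric.not_ae_hasLineDerivAt_zero {K : ℝ} (hK : 0 < K) {f : ℂ ≃ₜ ℂ}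
    (hf : WeaklyQuasisymmetric K f) {v : ℂ} (hv : v ≠ 0) :
    ¬ ∀ᵐ z, HasLineDerivAt ℝ f 0 z v := by
  intro h
  have hc : -Complex.I * v ≠ 0 := by simp [hv]
  refine (hf.comp_mulLeft hc).not_ae_hasLineDerivAt_I_zero hK ?_
  filter_upwards [(Complex.quasiMeasurePreserving_mul hc).ae h] with z hz
  refine (hasLineDerivAt_comp_mulLeft (f := f) (c := -Complex.I * v)).2 ?_
  have hv' : -Complex.I * v * Complex.I = v := by
    rw [mul_right_comm]
    simp
  rwa [hv']

theorem WeaklyQuasisymmetric.exists_isAsterisk {K : ℝ} (hK : 0 < K) {f : ℂ ≃ₜ ℂ}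
    (hf : WeaklyQuasisymmetric K f) : ∃ z, IsAsterisk f z := by
  by_contra! hno
  have hall : ∀ᵐ z, ∀ a b : ℚ, LineDifferentiableAt ℝ f z ⟨(a : ℝ), (b : ℝ)⟩ :=
    ae_all_iff.2 fun a => ae_all_iff.2 fun b => hf.ae_lineDifferentiableAt hK _
  refine hf.not_ae_hasLineDerivAt_zero hK one_ne_zero ?_
  filter_upwards [hall, hf.ae_lineDifferentiableAt hK 1] with z hz hz1
  have h0 : lineDeriv ℝ f z 1 = 0 := by
    by_contra h
    exact hno z ⟨hz, h⟩
  exact h0 ▸ hz1.hasLineDerivAt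

/-! ### Chordal distances and cross ratios -/

theorem Real.cosh_add_le_exp_mul_cosh (a : ℝ) {b : ℝ} (hb : 0 ≤ b) :
    Real.cosh (a + b) ≤ Real.exp b * Real.cosh a := by
  rw [Real.cosh_add, ← Real.cosh_add_sinh b]
  have := mul_le_mul_of_nonneg_right (Real.sinh_lt_cosh a).le (Real.sinh_nonneg_iff.2 hb)
  linarith

namespace H3

/-- The base point `(0, 1)`. -/
def base : H3 := ⟨0, 1, one_pos⟩

/-- The chordal distance of `p` and `q` in the ball model centred at `o`. -/
noncomputable def chord (o p q : H3) : ℝ :=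
  Real.sinh (dist p q / 2) / (Real.cosh (dist p o / 2) * Real.cosh (dist q o / 2))

theorem chord_nonneg (o p q : H3) : 0 ≤ chord o p q :=
  div_nonneg (Real.sinh_nonneg_iff.2 (by positivity)) (by positivity)

theorem chord_map (g : H3 ≃ᵢ H3) (o p q : H3) : chord (g o) (g p) (g q) = chord o p q := by
  simp [chord, g.dist_eq]

theorem cosh_half_dist_le (o o' p : H3) :
    Real.cosh (dist p o' / 2) ≤ Real.exp (dist o o' / 2) * Real.cosh (dist p o / 2) := by
  refine le_trans (Real.cosh_le_cosh.2 ?_) (Real.cosh_add_le_exp_mul_cosh _ (by positivity))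
  rw [abs_of_nonneg (by positivity), abs_of_nonneg (by positivity)]
  linarith [dist_triangle p o o']

theorem chord_le_exp_mul_chord (o o' p q : H3) :
    chord o p q ≤ Real.exp (dist o o') * chord o' p q := by
  have h0 : 0 ≤ Real.sinh (dist p q / 2) := Real.sinh_nonneg_iff.2 (by positivity)
  have h1 := cosh_half_dist_le o o' p
  have h2 := cosh_half_dist_le o o' q
  have he : Real.exp (dist o o') = Real.exp (dist o o' / 2) * Real.exp (dist o o' / 2) := by
    rw [← Real.exp_add, add_halves]
  rw [chord, chord, ← mul_div_assoc, div_le_div_iff₀ (by positivity) (by positivity), he]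
  calc _ ≤ Real.sinh (dist p q / 2) * ((Real.exp (dist o o' / 2) * Real.cosh (dist p o / 2)) *
        (Real.exp (dist o o' / 2) * Real.cosh (dist q o / 2))) := by gcongr
    _ = _ := by ring

/-- The `cosh` of half a distance is a Euclidean distance to a mirror image, so the chord is, up to
the factor `2 * o.t`, the Euclidean distance after inversion in `o.mirror`. -/
theorem chord_eq (o p q : H3) :
    chord o p q = 2 * o.t * dist p.toEuclidean q.toEuclidean /
      (dist p.toEuclidean o.mirror * dist q.toEuclidean o.mirror) := by
  have ho := o.t_pos
  have hp := p.t_pos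
  have hq := q.t_pos
  have sp : 0 < √p.t := Real.sqrt_pos.2 hp
  have sq : 0 < √q.t := Real.sqrt_pos.2 hq
  have so : 0 < √o.t := Real.sqrt_pos.2 ho
  have hoo : √o.t * √o.t = o.t := Real.mul_self_sqrt ho.le
  rw [chord, sinh_half_dist, cosh_half_dist, cosh_half_dist, Real.sqrt_mul hp.le,
    Real.sqrt_mul hp.le, Real.sqrt_mul hq.le]
  nth_rewrite 3 [← hoo]
  field_simp

theorem chord_sq (o p q : H3) :
    chord o p q ^ 2 = 4 * o.t ^ 2 * (‖p.z - q.z‖ ^ 2 + (p.t - q.t) ^ 2) /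
      ((‖p.z - o.z‖ ^ 2 + (p.t + o.t) ^ 2) * (‖q.z - o.z‖ ^ 2 + (q.t + o.t) ^ 2)) := by
  rw [chord_eq, div_pow, mul_pow, mul_pow, mul_pow, euclidean_dist_sq, mirror_dist_sq,
    mirror_dist_sq]
  norm_num

/-- The `cosh` factors cancel in a cross ratio, so the inequality does not depend on `o` and is
invariant under isometries. -/
theorem chord_mul_chord_le_iff (o p q r s : H3) (M : ℝ) :
    chord o p q * chord o r s ≤ M * (chord o p r * chord o q s) ↔
      Real.sinh (dist p q / 2) * Real.sinh (dist r s / 2) ≤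
        M * (Real.sinh (dist p r / 2) * Real.sinh (dist q s / 2)) := by
  have h : 0 < Real.cosh (dist p o / 2) * Real.cosh (dist q o / 2) *
      (Real.cosh (dist r o / 2) * Real.cosh (dist s o / 2)) := by positivity
  have h1 : chord o p q * chord o r s = Real.sinh (dist p q / 2) * Real.sinh (dist r s / 2) /
      (Real.cosh (dist p o / 2) * Real.cosh (dist q o / 2) *
      (Real.cosh (dist r o / 2) * Real.cosh (dist s o / 2))) := by
    rw [chord, chord, div_mul_div_comm]
  have h2 : M * (chord o p r * chord o q s) =
      M * (Real.sinh (dist p r / 2) * Real.sinh (dist q s / 2)) /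
      (Real.cosh (dist p o / 2) * Real.cosh (dist q o / 2) *
      (Real.cosh (dist r o / 2) * Real.cosh (dist s o / 2))) := by
    rw [chord, chord, div_mul_div_comm, ← mul_div_assoc]
    congr 1
    ring
  rw [h1, h2, div_le_div_iff_of_pos_right h]

end H3

/-- The images of the balls about `o` form an increasing open cover of the compact quotient, so one
of them is everything. -/
theorem IsNiceLattice.exists_dist_le {Γ : Subgroup (H3 ≃ᵢ H3)} (hΓ : IsNiceLattice Γ) (o : H3) :
    ∃ D : ℝ, ∀ p : H3, ∃ γ ∈ Γ, dist (γ p) o ≤ D := by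
  have := hΓ.compact
  have : ContinuousConstSMul Γ H3 := ⟨fun γ => γ.1.continuous⟩
  have hq := MulAction.isOpenQuotientMap_quotientMk (Γ := Γ) (T := H3)
  obtain ⟨n, hn⟩ := isCompact_univ.elim_directed_cover
    (fun n : ℕ => Quotient.mk (MulAction.orbitRel Γ H3) '' Metric.ball o n)
    (fun n => hq.isOpenMap _ Metric.isOpen_ball)
    (fun x _ => by
      obtain ⟨p, rfl⟩ := hq.surjective x
      obtain ⟨n, hn⟩ := exists_nat_gt (dist p o)
      exact mem_iUnion.2 ⟨n, p, hn, rfl⟩)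
    (Monotone.directed_le fun m n h => image_mono (Metric.ball_subset_ball (by exact_mod_cast h)))
  refine ⟨n, fun p => ?_⟩
  obtain ⟨q, hq, hqp⟩ := hn (mem_univ (Quotient.mk _ p))
  obtain ⟨γ, hγ⟩ := MulAction.orbitRel_apply.1 (Quotient.exact hqp)
  refine ⟨γ.1, γ.2, ?_⟩
  have : γ.1 p = q := hγ
  rw [this]
  exact (Metric.mem_ball.1 hq).le

/-! ### The closed half space as a compact ball -/

namespace ClosedH3

theorem toOnePoint_injective : Function.Injective toOnePoint := by
  intro X Y h
  cases X with
  | inner p =>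
    cases Y with
    | inner q =>
      have := OnePoint.coe_injective h
      rw [Prod.mk.injEq] at this
      rw [H3.ext this.1 this.2]
    | ideal y =>
      exfalso
      induction y using OnePoint.rec with
      | infty => exact OnePoint.coe_ne_infty _ h
      | coe z =>
        have := OnePoint.coe_injective h
        rw [Prod.mk.injEq] at this
        exact p.t_pos.ne' this.2
  | ideal x =>
    cases Y with
    | inner q =>
      exfalso
      induction x using OnePoint.rec with
      | infty => exact OnePoint.coe_ne_infty _ h.symm
      | coe z =>
        have := OnePoint.coe_injective h
        rw [Prod.mk.injEq] at this
        exact q.t_pos.ne this.2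
    | ideal y =>
      induction x using OnePoint.rec with
      | infty =>
        induction y using OnePoint.rec with
        | infty => rfl
        | coe z => exact absurd h.symm (OnePoint.coe_ne_infty _)
      | coe z =>
        induction y using OnePoint.rec with
        | infty => exact absurd h (OnePoint.coe_ne_infty _)
        | coe w =>
          have := OnePoint.coe_injective h
          rw [Prod.mk.injEq] at this
          rw [this.1]

theorem range_toOnePoint :
    range toOnePoint = {x : OnePoint (ℂ × ℝ) | ∀ p : ℂ × ℝ, x = p → 0 ≤ p.2} := by
  ext x
  constructor
  · rintro ⟨X, rfl⟩ p hp
    cases X with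
    | inner q =>
      obtain rfl := OnePoint.coe_injective hp
      exact q.t_pos.le
    | ideal y =>
      induction y using OnePoint.rec with
      | infty => exact absurd hp.symm (OnePoint.coe_ne_infty _)
      | coe z =>
        obtain rfl := OnePoint.coe_injective hp
        exact le_rfl
  · intro h
    induction x using OnePoint.rec with
    | infty => exact ⟨ideal OnePoint.infty, rfl⟩
    | coe p =>
      rcases (h p rfl).eq_or_lt with h0 | h0
      · refine ⟨ideal (p.1 : Sphere), ?_⟩
        change ((p.1, 0) : ℂ × ℝ) = (p : OnePoint (ℂ × ℝ))
        rw [h0]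
      · exact ⟨inner ⟨p.1, p.2, h0⟩, rfl⟩

theorem isClosedEmbedding_toOnePoint : IsClosedEmbedding toOnePoint := by
  refine ⟨⟨⟨rfl⟩, toOnePoint_injective⟩, ?_⟩
  rw [range_toOnePoint, OnePoint.isClosed_iff_of_mem]
  · have : ((↑) : ℂ × ℝ → OnePoint (ℂ × ℝ)) ⁻¹'
        {x : OnePoint (ℂ × ℝ) | ∀ p : ℂ × ℝ, x = p → 0 ≤ p.2} = {p | 0 ≤ p.2} := by
      ext p
      refine ⟨fun h => h p rfl, fun h q hq => ?_⟩
      obtain rfl := OnePoint.coe_injective hq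
      exact h
    rw [this]
    exact isClosed_le continuous_const continuous_snd
  · intro p hp
    exact absurd hp.symm (OnePoint.coe_ne_infty _)

instance : CompactSpace ClosedH3 := isClosedEmbedding_toOnePoint.compactSpace

/-- The position of `(z, |t|)` relative to `(0, -1)`. -/
noncomputable def shifted (p : ℂ × ℝ) : WithLp 2 (ℂ × ℝ) := WithLp.toLp 2 (p.1, |p.2| + 1)

theorem norm_shifted_sq (p : ℂ × ℝ) : ‖shifted p‖ ^ 2 = ‖p.1‖ ^ 2 + (|p.2| + 1) ^ 2 := by
  rw [WithLp.prod_norm_sq_eq_of_L2]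
  simp [shifted]

theorem one_le_norm_shifted (p : ℂ × ℝ) : 1 ≤ ‖shifted p‖ := by
  have h := norm_shifted_sq p
  nlinarith [abs_nonneg p.2, norm_nonneg (shifted p), sq_nonneg ‖p.1‖]

theorem norm_le_norm_shifted (p : ℂ × ℝ) : ‖p‖ ≤ ‖shifted p‖ := by
  have h := norm_shifted_sq p
  rw [Prod.norm_def, max_le_iff, Real.norm_eq_abs]
  constructor <;>
    nlinarith [abs_nonneg p.2, norm_nonneg (shifted p), sq_nonneg ‖p.1‖, norm_nonneg p.1]

theorem shifted_ne_zero (p : ℂ × ℝ) : shifted p ≠ 0 :=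
  norm_pos_iff.1 (one_pos.trans_le (one_le_norm_shifted p))

theorem continuous_shifted : Continuous shifted := by
  unfold shifted
  fun_prop

/-- The inversion centred at `(0, -1)`, which takes the closed upper half space to a closed ball. -/
noncomputable def toBall (X : ClosedH3) : WithLp 2 (ℂ × ℝ) :=
  X.toOnePoint.elim 0 fun p => (1 / ‖shifted p‖) ^ 2 • shifted p

theorem norm_inversion_shifted (p : ℂ × ℝ) :
    ‖(1 / ‖shifted p‖) ^ 2 • shifted p‖ = 1 / ‖shifted p‖ := by
  have := norm_pos_iff.2 (shifted_ne_zero p)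
  rw [norm_smul, Real.norm_of_nonneg (by positivity)]
  field_simp

theorem continuous_toBall : Continuous toBall := by
  have h : Continuous fun x : OnePoint (ℂ × ℝ) =>
      x.elim (0 : WithLp 2 (ℂ × ℝ)) fun p => (1 / ‖shifted p‖) ^ 2 • shifted p := by
    rw [OnePoint.continuous_iff]
    constructor
    · simp only [OnePoint.elim_some, OnePoint.elim_infty]
      rw [tendsto_zero_iff_norm_tendsto_zero, coclosedCompact_eq_cocompact]
      simp_rw [norm_inversion_shifted, one_div]
      exact tendsto_inv_atTop_zero.comp
        (tendsto_atTop_mono norm_le_norm_shifted tendsto_norm_cocompact_atTop)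
    · simp only [OnePoint.elim_some]
      exact ((continuous_const.div continuous_shifted.norm
        fun p => norm_ne_zero_iff.2 (shifted_ne_zero p)).pow 2).smul continuous_shifted
  exact h.comp continuous_induced_dom

theorem norm_toBall_le_one (X : ClosedH3) : ‖toBall X‖ ≤ 1 := by
  unfold toBall
  induction X.toOnePoint using OnePoint.rec with
  | infty => simp
  | coe p =>
    rw [OnePoint.elim_some, norm_inversion_shifted]
    exact (div_le_one (by linarith [one_le_norm_shifted p])).2 (one_le_norm_shifted p)

theorem dist_toBall_le_two (X Y : ClosedH3) : dist (toBall X) (toBall Y) ≤ 2 := by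
  rw [dist_eq_norm]
  linarith [norm_sub_le (toBall X) (toBall Y), norm_toBall_le_one X, norm_toBall_le_one Y]

theorem dist_inversion_shifted (p q : ℂ × ℝ) :
    dist ((1 / ‖shifted p‖) ^ 2 • shifted p) ((1 / ‖shifted q‖) ^ 2 • shifted q) =
      dist (shifted p) (shifted q) / (‖shifted p‖ * ‖shifted q‖) := by
  rw [dist_div_norm_sq_smul (shifted_ne_zero p) (shifted_ne_zero q)]
  ring

theorem shifted_eq (p : H3) : shifted (p.z, p.t) = p.toEuclidean - H3.base.mirror := by
  simp only [shifted, H3.toEuclidean, H3.mirror, H3.base, abs_of_pos p.t_pos, ← WithLp.toLp_sub,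
    Prod.mk_sub_mk]
  simp

theorem dist_toBall_inner (p q : H3) :
    dist (toBall (inner p)) (toBall (inner q)) = H3.chord H3.base p q / 2 := by
  change dist ((1 / ‖shifted (p.z, p.t)‖) ^ 2 • shifted (p.z, p.t))
    ((1 / ‖shifted (q.z, q.t)‖) ^ 2 • shifted (q.z, q.t)) = _
  rw [dist_inversion_shifted, shifted_eq, shifted_eq, dist_sub_right, H3.chord_eq,
    ← dist_eq_norm, ← dist_eq_norm]
  simp only [H3.base]
  ring

theorem dist_toBall_ideal (z w : ℂ) :
    dist (toBall (ideal z)) (toBall (ideal w)) =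
      dist z w / (‖shifted (z, 0)‖ * ‖shifted (w, 0)‖) := by
  change dist ((1 / ‖shifted (z, 0)‖) ^ 2 • shifted (z, 0))
    ((1 / ‖shifted (w, 0)‖) ^ 2 • shifted (w, 0)) = _
  rw [dist_inversion_shifted]
  congr 1
  rw [shifted, shifted, WithLp.prod_dist_eq_of_L2]
  simp

theorem dist_toBall_ideal_infty (z : ℂ) :
    dist (toBall (ideal z)) (toBall (ideal OnePoint.infty)) = 1 / ‖shifted (z, 0)‖ := by
  change dist ((1 / ‖shifted (z, 0)‖) ^ 2 • shifted (z, 0)) 0 = _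
  rw [dist_zero_right, norm_inversion_shifted]

/-- The absolute value in `shifted` identifies `(z, t)` with `(z, -t)`; this is harmless because
heights in the closed half space are nonnegative. -/
theorem toBall_injective : Function.Injective toBall := by
  intro X Y h
  apply toOnePoint_injective
  have hX : ∀ p : ℂ × ℝ, (∃ Z, toOnePoint Z = (p : OnePoint (ℂ × ℝ))) → 0 ≤ p.2 := fun p hp => by
    have : (p : OnePoint (ℂ × ℝ)) ∈ range toOnePoint := hp
    rw [range_toOnePoint] at this
    exact this p rfl
  have hX1 : ∀ p : ℂ × ℝ, X.toOnePoint = (p : OnePoint (ℂ × ℝ)) → 0 ≤ p.2 := fun p hp => hX p ⟨X, hp⟩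
  have hY1 : ∀ p : ℂ × ℝ, Y.toOnePoint = (p : OnePoint (ℂ × ℝ)) → 0 ≤ p.2 := fun p hp => hX p ⟨Y, hp⟩
  unfold toBall at h
  have hne : ∀ p, (1 / ‖shifted p‖) ^ 2 • shifted p ≠ 0 := fun p =>
    smul_ne_zero (pow_ne_zero 2 (one_div_ne_zero (norm_ne_zero_iff.2 (shifted_ne_zero p))))
      (shifted_ne_zero p)
  revert h hX1 hY1
  induction X.toOnePoint using OnePoint.rec with
  | infty =>
    induction Y.toOnePoint using OnePoint.rec with
    | infty => intros; rfl
    | coe q => exact fun h => absurd h.symm (hne q)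
  | coe p =>
    induction Y.toOnePoint using OnePoint.rec with
    | infty => exact fun h => absurd h (hne p)
    | coe q =>
      intro h hp hq
      have hd := dist_eq_zero.2 h
      simp only [OnePoint.elim_some] at hd
      rw [dist_inversion_shifted, div_eq_zero_iff, or_iff_left (mul_ne_zero
        (norm_ne_zero_iff.2 (shifted_ne_zero p)) (norm_ne_zero_iff.2 (shifted_ne_zero q))),
        dist_eq_zero, shifted, shifted, abs_of_nonneg (hp p rfl), abs_of_nonneg (hq q rfl),
        (WithLp.toLp_injective 2).eq_iff, Prod.mk.injEq, add_left_inj] at hd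
      rw [Prod.ext hd.1 hd.2]

theorem tendsto_inner_ideal (z : ℂ) {ι : Type*} {l : Filter ι} {p : ι → H3}
    (hz : ∀ i, (p i).z = z) (ht : Tendsto (fun i => (p i).t) l (𝓝 0)) :
    Tendsto (fun i => inner (p i)) l (𝓝 (ideal z)) := by
  rw [isClosedEmbedding_toOnePoint.isInducing.tendsto_nhds_iff]
  refine (OnePoint.continuous_coe.tendsto ((z, 0) : ℂ × ℝ)).comp ?_
  simp_rw [hz]
  exact tendsto_const_nhds.prodMk_nhds ht

theorem tendsto_inner_infty {ι : Type*} {l : Filter ι} {p : ι → H3}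
    (ht : Tendsto (fun i => (p i).t) l atTop) :
    Tendsto (fun i => inner (p i)) l (𝓝 (ideal OnePoint.infty)) := by
  rw [isClosedEmbedding_toOnePoint.isInducing.tendsto_nhds_iff]
  refine (OnePoint.tendsto_coe_infty (X := ℂ × ℝ)).comp ?_
  rw [coclosedCompact_eq_cocompact, ← Metric.cobounded_eq_cocompact,
    ← tendsto_norm_atTop_iff_cobounded]
  refine tendsto_atTop_mono (fun i => ?_) ht
  exact (le_abs_self _).trans (norm_snd_le ((p i).z, (p i).t))

theorem glue_injective {H : H3 → H3} {h : Sphere → Sphere} (hH : Function.Injective H)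
    (hh : Function.Injective h) : Function.Injective (glue H h) := by
  rintro (p | x) (q | y) hxy
  · simp only [glue, inner.injEq] at hxy
    rw [hH hxy]
  · simp [glue] at hxy
  · simp [glue] at hxy
  · simp only [glue, ideal.injEq] at hxy
    rw [hh hxy]

/-- The pairs at distance at least `c` form a compact set off the diagonal, on which the distance of
the images attains a positive minimum. -/
theorem exists_le_dist_toBall {F : ClosedH3 → ClosedH3} (hF : Continuous F)
    (hinj : Function.Injective F) {c : ℝ} (hc : 0 < c) :
    ∃ ε > 0, ∀ X Y, c ≤ dist (toBall X) (toBall Y) → ε ≤ dist (toBall (F X)) (toBall (F Y)) := by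
  let S : Set (ClosedH3 × ClosedH3) := {P | c ≤ dist (toBall P.1) (toBall P.2)}
  have hS : IsCompact S := (isClosed_le continuous_const
    ((continuous_toBall.comp continuous_fst).dist (continuous_toBall.comp continuous_snd))).isCompact
  have hcont : Continuous fun P : ClosedH3 × ClosedH3 => dist (toBall (F P.1)) (toBall (F P.2)) :=
    (continuous_toBall.comp (hF.comp continuous_fst)).dist
      (continuous_toBall.comp (hF.comp continuous_snd))
  rcases S.eq_empty_or_nonempty with hE | hE
  · exact ⟨1, one_pos, fun X Y h => absurd (show (X, Y) ∈ S from h) (by simp [hE])⟩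
  · obtain ⟨P, hP, hmin⟩ := hS.exists_isMinOn hE hcont.continuousOn
    refine ⟨dist (toBall (F P.1)) (toBall (F P.2)), dist_pos.2 fun h => ?_, fun X Y h => ?_⟩
    swap
    · exact isMinOn_iff.1 hmin (X, Y) h
    have h1 : P.1 = P.2 := hinj (toBall_injective h)
    have h2 : c ≤ dist (toBall P.1) (toBall P.2) := hP
    rw [h1, dist_self] at h2
    linarith

end ClosedH3

/-! ### Quasisymmetry from equivariance -/

open ClosedH3 in
theorem exists_chord_mul_chord_le {H : Equiv.Perm H3} {h : Sphere ≃ₜ Sphere}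
    (hpair : IsEquivariantPair H h) {c : ℝ} (hc : 0 < c) :
    ∃ M > 0, ∀ o p q r s : H3, c ≤ H3.chord o p r → c ≤ H3.chord o q s →
      H3.chord H3.base (H p) (H q) * H3.chord H3.base (H r) (H s) ≤
        M * (H3.chord H3.base (H p) (H r) * H3.chord H3.base (H q) (H s)) := by
  obtain ⟨Γ₁, Γ₂, hΓ₁, -, hconj, -⟩ := hpair.equivariant
  obtain ⟨D, hD⟩ := hΓ₁.exists_dist_le H3.base
  obtain ⟨ε, hε, hεF⟩ := exists_le_dist_toBall hpair.ext (glue_injective H.injective h.injective)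
    -- Moving the centre to the base point costs a factor `exp D`, and a chord is twice a distance
    -- under `toBall`.
    (c := c * Real.exp (-D) / 2) (by positivity)
  have hsep : ∀ o p q : H3, c ≤ H3.chord o p q → ∀ γ : H3 ≃ᵢ H3, dist (γ o) H3.base ≤ D →
      2 * ε ≤ H3.chord H3.base (H (γ p)) (H (γ q)) := by
    intro o p q hpq γ hγ
    have h1 := hεF (inner (γ p)) (inner (γ q)) (by
      rw [dist_toBall_inner]
      have h2 := H3.chord_le_exp_mul_chord (γ o) H3.base (γ p) (γ q)
      rw [H3.chord_map] at h2
      have h3 : c ≤ Real.exp D * H3.chord H3.base (γ p) (γ q) := by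
        refine hpq.trans (h2.trans ?_)
        gcongr
        exact H3.chord_nonneg _ _ _
      rw [Real.exp_neg, ← div_eq_mul_inv]
      gcongr
      rwa [div_le_iff₀' (Real.exp_pos D)])
    have h4 := dist_toBall_inner (H (γ p)) (H (γ q))
    change ε ≤ dist (toBall (inner (H (γ p)))) (toBall (inner (H (γ q)))) at h1
    linarith
  have hle : ∀ p q : H3, H3.chord H3.base p q ≤ 4 := fun p q => by
    have h1 := dist_toBall_le_two (inner p) (inner q)
    rw [dist_toBall_inner] at h1
    linarith
  refine ⟨4 / ε ^ 2, by positivity, fun o p q r s hpr hqs => ?_⟩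
  obtain ⟨γ, hγ, hγo⟩ := hD o
  obtain ⟨γ', -, hγ'⟩ : H * γ.toEquiv * H⁻¹ ∈ IsometryEquiv.toEquiv '' (Γ₂ : Set (H3 ≃ᵢ H3)) :=
    hconj ▸ mem_image_of_mem _ hγ
  have hcomm : ∀ x, H (γ x) = γ' (H x) := fun x => by
    have h1 := congrArg (fun e : Equiv.Perm H3 => e (H x)) hγ'
    simpa using h1.symm
  have hdist : ∀ x y, dist (H (γ x)) (H (γ y)) = dist (H x) (H y) := fun x y => by
    rw [hcomm, hcomm, γ'.dist_eq]
  -- The cross ratio of the images does not change when all four points are first moved by `γ`;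
  -- after that, each chord on the left is at most `4` and each on the right at least `2 * ε`.
  rw [H3.chord_mul_chord_le_iff, ← hdist p q, ← hdist r s, ← hdist p r, ← hdist q s,
    ← H3.chord_mul_chord_le_iff H3.base]
  calc _ ≤ (4 : ℝ) * 4 := by
        gcongr
        · exact H3.chord_nonneg _ _ _
        · exact hle _ _
        · exact hle _ _
    _ = 4 / ε ^ 2 * (2 * ε * (2 * ε)) := by
        field_simp
        norm_num
    _ ≤ _ := by
        gcongr
        · exact H3.chord_nonneg _ _ _
        · exact hsep o p r hpr γ hγo
        · exact hsep o q s hqs γ hγo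

theorem H3.eventually_one_le_chord {z w : ℂ} {r : ℝ} (hr : 0 < r) (hw : ‖z - w‖ = r)
    {o : H3} (ho : o.z = z ∧ o.t = r) {ι : Type*} {l : Filter ι} {p q : ι → H3}
    (hp : ∀ i, (p i).z = z) (hq : ∀ i, (q i).z = w) (hpq : ∀ i, (p i).t = (q i).t)
    (ht : Tendsto (fun i => (q i).t) l (𝓝 0)) : ∀ᶠ i in l, 1 ≤ chord o (p i) (q i) := by
  have hlim : Tendsto (fun t : ℝ => 4 * r ^ 2 * r ^ 2 / ((t + r) ^ 2 * (r ^ 2 + (t + r) ^ 2)))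
      (𝓝 0) (𝓝 (4 * r ^ 2 * r ^ 2 / ((0 + r) ^ 2 * (r ^ 2 + (0 + r) ^ 2)))) := by
    refine ContinuousAt.tendsto (f := fun t : ℝ =>
      4 * r ^ 2 * r ^ 2 / ((t + r) ^ 2 * (r ^ 2 + (t + r) ^ 2))) ?_
    refine ContinuousAt.div (by fun_prop) (by fun_prop) ?_
    positivity
  -- The limit of the squared chord is `2`: from `o`, the ideal points `z` and `w` appear at a right
  -- angle.
  have hval : 1 < 4 * r ^ 2 * r ^ 2 / ((0 + r) ^ 2 * (r ^ 2 + (0 + r) ^ 2)) := by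
    rw [one_lt_div (by positivity)]
    nlinarith [pow_pos hr 4]
  filter_upwards [(hlim.comp ht).eventually_const_lt hval] with i hi
  rw [← one_le_sq_iff₀ (chord_nonneg _ _ _), chord_sq, hp, hq, hpq, ho.1, ho.2, hw,
    norm_sub_rev w z, hw]
  simp only [Function.comp_apply] at hi
  simpa using hi.le

theorem H3.eventually_one_le_chord_vertical {z w : ℂ} {r : ℝ} (hr : 0 < r) (hw : ‖w - z‖ ≤ r)
    {o : H3} (ho : o.z = z ∧ o.t = r) {ι : Type*} {l : Filter ι} {q s : ι → H3}
    (hq : ∀ i, (q i).z = w) (hs : ∀ i, (s i).z = z) (hqs : ∀ i, (s i).t = ((q i).t)⁻¹)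
    (ht : Tendsto (fun i => (q i).t) l (𝓝 0)) : ∀ᶠ i in l, 1 ≤ chord o (q i) (s i) := by
  have hlim : Tendsto (fun t : ℝ =>
      4 * r ^ 2 * (1 - t ^ 2) ^ 2 / ((r ^ 2 + (t + r) ^ 2) * (1 + r * t) ^ 2))
      (𝓝 0) (𝓝 (4 * r ^ 2 * (1 - 0 ^ 2) ^ 2 / ((r ^ 2 + (0 + r) ^ 2) * (1 + r * 0) ^ 2))) := by
    refine ContinuousAt.tendsto (f := fun t : ℝ =>
      4 * r ^ 2 * (1 - t ^ 2) ^ 2 / ((r ^ 2 + (t + r) ^ 2) * (1 + r * t) ^ 2)) ?_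
    refine ContinuousAt.div (by fun_prop) (by fun_prop) ?_
    positivity
  have hval : 1 < 4 * r ^ 2 * (1 - 0 ^ 2) ^ 2 / ((r ^ 2 + (0 + r) ^ 2) * (1 + r * 0) ^ 2) := by
    rw [one_lt_div (by positivity)]
    nlinarith [pow_pos hr 2]
  filter_upwards [(hlim.comp ht).eventually_const_lt hval] with i hi
  have hti := (q i).t_pos
  rw [← one_le_sq_iff₀ (chord_nonneg _ _ _), chord_sq, hq, hs, hqs, ho.1, ho.2]
  simp only [Function.comp_apply] at hi
  refine hi.le.trans ?_
  -- Multiplying through by the square of the height of `q i` removes the inverse heights and gives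
  -- an expression continuous at height zero.
  have he : 4 * r ^ 2 * (1 - (q i).t ^ 2) ^ 2 /
      ((r ^ 2 + ((q i).t + r) ^ 2) * (1 + r * (q i).t) ^ 2) =
      4 * r ^ 2 * ((q i).t - (q i).t⁻¹) ^ 2 /
      ((r ^ 2 + ((q i).t + r) ^ 2) * (((q i).t)⁻¹ + r) ^ 2) := by
    field_simp
    ring
  rw [he, sub_self, norm_zero]
  gcongr
  · nlinarith [sq_nonneg ‖w - z‖]
  · nlinarith

/-- The homeomorphism of the plane given by a homeomorphism of the sphere that fixes `∞`. -/
noncomputable def planeHomeo (h : Sphere ≃ₜ Sphere) (hinf : h OnePoint.infty = OnePoint.infty) :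
    ℂ ≃ₜ ℂ where
  toFun := planeMap h hinf
  invFun := planeMap h.symm (h.symm_apply_eq.2 hinf.symm)
  left_inv z := OnePoint.coe_injective (by simp [coe_planeMap])
  right_inv z := OnePoint.coe_injective (by simp [coe_planeMap])
  continuous_toFun := by
    rw [OnePoint.isOpenEmbedding_coe.isInducing.continuous_iff]
    exact (h.continuous.comp OnePoint.continuous_coe).congr fun z => (coe_planeMap h hinf z).symm
  continuous_invFun := by
    rw [OnePoint.isOpenEmbedding_coe.isInducing.continuous_iff]
    exact (h.symm.continuous.comp OnePoint.continuous_coe).congr fun z =>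
      (coe_planeMap h.symm _ z).symm

open ClosedH3 in
theorem IsEquivariantPair.weaklyQuasisymmetric {H : Equiv.Perm H3} {h : Sphere ≃ₜ Sphere}
    (hpair : IsEquivariantPair H h) (hinf : h OnePoint.infty = OnePoint.infty) :
    ∃ K > 0, WeaklyQuasisymmetric K (planeMap h hinf) := by
  obtain ⟨M, hM, hMH⟩ := exists_chord_mul_chord_le hpair one_pos
  refine ⟨M, hM, fun z w₁ w₂ hw => ?_⟩
  rcases eq_or_ne w₂ z with rfl | hne
  · have : w₁ = w₂ := dist_le_zero.1 (by simpa using hw)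
    simp [this]
  set r := dist w₂ z with hr_def
  have hr : 0 < r := dist_pos.2 hne
  have hzw : ‖z - w₂‖ = r := by rw [hr_def, dist_comm, dist_eq_norm]
  let τ : ℕ → ℝ := fun n => 1 / ((n : ℝ) + 1)
  have hτ0 : ∀ n, 0 < τ n := fun n => by positivity
  have hτ : Tendsto τ atTop (𝓝 0) := tendsto_one_div_add_atTop_nhds_zero_nat
  let p : ℂ → ℕ → H3 := fun w n => ⟨w, τ n, hτ0 n⟩
  let s : ℕ → H3 := fun n => ⟨z, (τ n)⁻¹, inv_pos.2 (hτ0 n)⟩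
  have hs : Tendsto (fun n => inner (s n)) atTop (𝓝 (ideal OnePoint.infty)) :=
    tendsto_inner_infty (tendsto_inv_nhdsGT_zero.comp
      (tendsto_nhdsWithin_iff.2 ⟨hτ, Eventually.of_forall hτ0⟩))
  have hp : ∀ w, Tendsto (fun n => inner (p w n)) atTop (𝓝 (ideal w)) := fun w =>
    tendsto_inner_ideal w (fun _ => rfl) hτ
  have hF : ∀ {P : ℕ → H3} {x : Sphere}, Tendsto (fun n => inner (P n)) atTop (𝓝 (ideal x)) →
      Tendsto (fun n => toBall (inner (H (P n)))) atTop (𝓝 (toBall (ideal (h x)))) :=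
    fun {P x} hP => ((continuous_toBall.comp hpair.ext).tendsto (ideal x)).comp hP
  have hineq : ∀ᶠ n in atTop,
      dist (toBall (inner (H (p z n)))) (toBall (inner (H (p w₁ n)))) *
        dist (toBall (inner (H (p w₂ n)))) (toBall (inner (H (s n)))) ≤
      M * (dist (toBall (inner (H (p z n)))) (toBall (inner (H (p w₂ n)))) *
        dist (toBall (inner (H (p w₁ n)))) (toBall (inner (H (s n))))) := by
    filter_upwards [H3.eventually_one_le_chord (o := ⟨z, r, hr⟩) hr hzw ⟨rfl, rfl⟩ (p := p z) (q := p w₂)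
        (fun _ => rfl) (fun _ => rfl) (fun _ => rfl) hτ,
      H3.eventually_one_le_chord_vertical (o := ⟨z, r, hr⟩) hr
        (by rwa [← dist_eq_norm]) ⟨rfl, rfl⟩ (q := p w₁) (s := s)
        (fun _ => rfl) (fun _ => rfl) (fun _ => rfl) hτ] with n h1 h2
    have h3 := hMH ⟨z, r, hr⟩ _ _ _ _ h1 h2
    simp only [dist_toBall_inner]
    linarith
  -- In the limit the factors `‖shifted _‖` on the two sides have the same product, so only the
  -- Euclidean distances to the image of `z` remain.
  have hlim := le_of_tendsto_of_tendsto
    (((hF (hp z)).dist (hF (hp w₁))).mul ((hF (hp w₂)).dist (hF hs)))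
    ((((hF (hp z)).dist (hF (hp w₂))).mul ((hF (hp w₁)).dist (hF hs))).const_mul M) hineq
  rw [hinf, ← coe_planeMap h hinf, ← coe_planeMap h hinf, ← coe_planeMap h hinf,
    dist_toBall_ideal, dist_toBall_ideal, dist_toBall_ideal_infty, dist_toBall_ideal_infty] at hlim
  have ha := norm_pos_iff.2 (shifted_ne_zero (planeMap h hinf z, 0))
  have hb := norm_pos_iff.2 (shifted_ne_zero (planeMap h hinf w₁, 0))
  have hc := norm_pos_iff.2 (shifted_ne_zero (planeMap h hinf w₂, 0))
  rw [dist_comm (planeMap h hinf w₁), dist_comm (planeMap h hinf w₂)]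
  refine le_of_mul_le_mul_right ?_ (inv_pos.2 (mul_pos ha (mul_pos hb hc)))
  calc _ = _ := ?_
    _ ≤ _ := hlim
    _ = _ := ?_
  · field_simp
  · field_simp

theorem theorem3 (H : Equiv.Perm H3) (h : Sphere ≃ₜ Sphere) (hpair : IsEquivariantPair H h)
    (hinf : h OnePoint.infty = OnePoint.infty) :
    ∃ z : ℂ, IsAsterisk (planeMap h hinf) z := by
  obtain ⟨K, hK, hf⟩ := hpair.weaklyQuasisymmetric hinf
  exact WeaklyQuasisymmetric.exists_isAsterisk (f := planeHomeo h hinf) hK hf
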